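/- Let $(M,g)$ be a spacetime: a smooth four-dimensional manifold with a smooth Lorentzian metric of signature $(-,+,+,+)$. Suppose that it is axisymmetric, i.e. there is a smooth effective action $\tau:\mathbb T\times M\to M$, $(\phi,x)\mapsto\tau_\phi(x)$, of the one-dimensional torus $\mathbb T=\mathbb R/2\pi\mathbb Z$ by isometries of $(M,g)$ whose set of fixed points $W_2=\{x\in M:\tau_\phi(x)=x\ \text{for all }\phi\in\mathbb T\}$ (the axis) is a two-dimensional embedded surface in $M$. Let $\vec\sigma$ be the axial Killing vector field, $\vec\sigma|_x=\frac{d}{d\phi}\tau_\phi(x)\big|_{\phi=0}$. For $Q\in W_2$, a vector in $T_QM$ is called tangent to the axis if it lies in the tangent plane $T_QW_2$, and normal to the axis if it is $g$-orthogonal to $T_QW_2$. **Theorem 2.** Let $\vec\alpha$ be a smooth vector field on $M$ and let $Q\in W_2$. 1. $\vec\alpha|_Q$ is tangent to the axis if and only if $[\vec\alpha,\vec\sigma]|_Q=\vec 0$. 2. $\vec\alpha|_Q$ is nonzero and normal to the axis if and only if $\vec\alpha|_Q$ and $[\vec\alpha,\vec\sigma]|_Q$ are linearly independent and $[[\vec\alpha,\vec\sigma],\vec\sigma]|_Q$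 is a linear combination of $\vec\alpha|_Q$ and $[\vec\alpha,\vec\sigma]|_Q$. 3. $\vec\alpha|_Q$ is neither tangent nor normal to the axis if and only if $\vec\alpha|_Q$, $[\vec\alpha,\vec\sigma]|_Q$ and $[[\vec\alpha,\vec\sigma],\vec\sigma]|_Q$ are linearly independent and $[[[\vec\alpha,\vec\sigma],\vec\sigma],\vec\sigma]|_Q$ is a linear combination of $[\vec\alpha,\vec\sigma]|_Q$ and $[[\vec\alpha,\vec\sigma],\vec\sigma]|_Q$. -/

import Mathlib

open Set Filter
open scoped Manifold ContDiff Topology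

noncomputable section

/-- A smooth Lorentzian metric, of signature `(-,+,+,+)`, on a four-dimensional manifold. -/
structure LorentzianMetric (M : Type*) [TopologicalSpace M]
    [ChartedSpace (EuclideanSpace ℝ (Fin 4)) M] [IsManifold (𝓡 4) ∞ M] where
  /-- The bilinear form on each tangent space. -/
  inner (x : M) : TangentSpace (𝓡 4) x →L[ℝ] TangentSpace (𝓡 4) x →L[ℝ] ℝ
  symm : ∀ (x : M) (v w : TangentSpace (𝓡 4) x), inner x v w = inner x w v
  signature : ∀ x : M, ∃ b : Module.Basis (Fin 4) ℝ (TangentSpace (𝓡 4) x),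
    ∀ i j : Fin 4, inner x (b i) (b j) = if i = j then (if i = 0 then -1 else 1) else 0
  contMDiff : ContMDiff (𝓡 4)
    ((𝓡 4).prod 𝓘(ℝ, EuclideanSpace ℝ (Fin 4) →L[ℝ] EuclideanSpace ℝ (Fin 4) →L[ℝ] ℝ)) ∞
    (fun x => Bundle.TotalSpace.mk'
      (EuclideanSpace ℝ (Fin 4) →L[ℝ] EuclideanSpace ℝ (Fin 4) →L[ℝ] ℝ)
      (E := fun x : M => TangentSpace (𝓡 4) x →L[ℝ] TangentSpace (𝓡 4) x →L[ℝ] ℝ)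
      x (inner x))

section Submanifold

variable {M : Type*} [TopologicalSpace M] [ChartedSpace (EuclideanSpace ℝ (Fin 4)) M]

/-- `S` is a (nonempty, embedded) two-dimensional surface in the four-dimensional manifold `M`:
around each of its points there is a smooth chart of `M` in which `S` is the coordinate plane
where the last two coordinates vanish. -/
def IsTwoSurface (S : Set M) : Prop :=
  S.Nonempty ∧ ∀ Q ∈ S, ∃ e ∈ IsManifold.maximalAtlas (𝓡 4) ∞ M, Q ∈ e.source ∧
    ∀ x ∈ e.source, x ∈ S ↔ (e x) 2 = 0 ∧ (e x) 3 = 0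

/-- The vector `v` at `Q` is tangent to `S`: it is the velocity at `Q` of a smooth curve that
passes through `Q` and stays in `S`. -/
def IsTangentTo (S : Set M) (Q : M) (v : TangentSpace (𝓡 4) Q) : Prop :=
  ∃ γ : ℝ → M, γ 0 = Q ∧ (∀ᶠ t in 𝓝 (0 : ℝ), γ t ∈ S) ∧
    ContMDiffAt 𝓘(ℝ, ℝ) (𝓡 4) ∞ γ 0 ∧ mfderiv 𝓘(ℝ, ℝ) (𝓡 4) γ 0 (1 : ℝ) = v

variable [IsManifold (𝓡 4) ∞ M]

/-- The vector `v` at `Q` is normal to `S`: it is orthogonal to every vector tangent to `S`. -/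
def IsNormalTo (g : LorentzianMetric M) (S : Set M) (Q : M) (v : TangentSpace (𝓡 4) Q) : Prop :=
  ∀ w : TangentSpace (𝓡 4) Q, IsTangentTo S Q w → g.inner Q v w = 0

/-- An axial symmetry of the spacetime `(M, g)`: a smooth effective action of the one-dimensional
torus by isometries whose set of fixed points is a two-dimensional surface. -/
structure AxialSymmetry (g : LorentzianMetric M) where
  /-- The action of the torus. -/
  τ : Circle → M → M
  one_act : ∀ x, τ 1 x = x
  mul_act : ∀ z w x, τ (z * w) x = τ z (τ w x)
  contMDiff : ContMDiff ((𝓡 1).prod (𝓡 4)) (𝓡 4) ∞ (fun p : Circle × M => τ p.1 p.2)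
  isometry : ∀ (z : Circle) (x : M) (v w : TangentSpace (𝓡 4) x),
    g.inner (τ z x) (mfderiv (𝓡 4) (𝓡 4) (τ z) x v) (mfderiv (𝓡 4) (𝓡 4) (τ z) x w) =
      g.inner x v w
  effective : ∀ z, (∀ x, τ z x = x) → z = 1
  isTwoSurface_fixedPoints : IsTwoSurface {x : M | ∀ z, τ z x = x}

namespace AxialSymmetry

variable {g : LorentzianMetric M} (A : AxialSymmetry g)

/-- The axis of symmetry: the set of fixed points of the action. -/
def axis : Set M := {x | ∀ z, A.τ z x = x}

/-- The axial Killing vector field, `σ(x) = d/dφ τ_φ(x)` at `φ = 0`. -/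
def killing (x : M) : TangentSpace (𝓡 4) x :=
  mfderiv 𝓘(ℝ, ℝ) (𝓡 4) (fun φ : ℝ => A.τ (Circle.exp φ) x) 0 (1 : ℝ)

/-- The Lie bracket `[X, σ]` of a vector field with the axial Killing vector field. -/
def bracket (X : (x : M) → TangentSpace (𝓡 4) x) : (x : M) → TangentSpace (𝓡 4) x :=
  VectorField.mlieBracket (𝓡 4) X A.killing

end AxialSymmetry

end Submanifold

end

/-! Let `L` be the linearization of the Killing field at `Q`. Since the field vanishes at `Q`, its
bracket with any `X` has the value `L (X Q)` there (`bracket_eq`), so the iterated brackets of `α`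
at `Q` are `L v`, `L² v`, `L³ v` with `v = α Q`, and everything reduces to linear algebra.

`L` generates the isotropy action of the circle on the tangent space. It is therefore skew for `g`,
and also for a positive definite form `B` obtained by averaging over the circle
(`exists_invariant_form`). It is nonzero, since otherwise a whole neighbourhood of `Q` would be
fixed (`linearization_ne_zero`), and a nonzero `B`-skew operator has rank at least two. The tangent
plane of the axis lies in the kernel, so in dimension four the rank is exactly two and the kernel is
that plane.

A skew operator of rank two satisfies `L² = a` on its range with `a ≠ 0`, and the range is the
`g`-orthogonal of the kernel. Thus tangent means `L v = 0`, normal means `L² v = a v`, and always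
`L³ v = a L v`; the criteria follow (`orthogonal_and_oblique_criteria`). -/

/-! ### Linear algebra of skew operators. -/

section SkewOperator

variable {V : Type*} [AddCommGroup V] [Module ℝ V] {L : V →ₗ[ℝ] V} {B : V →ₗ[ℝ] V →ₗ[ℝ] ℝ}

/-- By skewness `B (L u) (L u) = -B u (L (L u))`, so positivity makes the kernels of `L` and `L²`
agree. -/
theorem apply_eq_zero_of_skew (hpos : ∀ v, v ≠ 0 → 0 < B v v)
    (hskew : ∀ u v, B (L u) v = -B u (L v)) {u : V} (hu : L (L u) = 0) : L u = 0 := by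
  by_contra h
  have h1 := hpos _ h
  rw [hskew, hu] at h1
  simp at h1

theorem inner_apply_self_of_skew (hsymm : ∀ u v, B u v = B v u)
    (hskew : ∀ u v, B (L u) v = -B u (L v)) (u : V) : B u (L u) = 0 := by
  have h1 := hskew u u
  rw [hsymm] at h1
  linarith

/-- If the range were at most a line, `L u` and `L (L u)` would be both parallel and `B`-orthogonal,
forcing `L (L u) = 0` and hence `L u = 0` for every `u`. -/
theorem two_le_finrank_range_of_skew [FiniteDimensional ℝ V] (hpos : ∀ v, v ≠ 0 → 0 < B v v)
    (hsymm : ∀ u v, B u v = B v u)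
    (hskew : ∀ u v, B (L u) v = -B u (L v)) (hL : L ≠ 0) :
    2 ≤ Module.finrank ℝ (LinearMap.range L) := by
  by_contra! h
  have h1 : Module.finrank ℝ (LinearMap.range L) ≤ 1 := by omega
  obtain ⟨w, hw⟩ := finrank_le_one_iff.1 h1
  refine hL (LinearMap.ext fun u => ?_)
  apply apply_eq_zero_of_skew hpos hskew
  obtain ⟨c, hc⟩ := hw ⟨L u, u, rfl⟩
  obtain ⟨d, hd⟩ := hw ⟨L (L u), L u, rfl⟩
  have hc' : c • (w : V) = L u := congrArg Subtype.val hc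
  have hd' : d • (w : V) = L (L u) := congrArg Subtype.val hd
  by_contra hne
  have h2 := hpos _ hne
  have h3 := inner_apply_self_of_skew hsymm hskew (L u)
  rw [← hd', ← hc'] at h3
  rw [← hd'] at h2 hne
  simp only [map_smul, LinearMap.smul_apply, smul_eq_mul] at h2 h3
  have hd0 : d ≠ 0 := by rintro rfl; simp at hne
  rcases mul_eq_zero.1 h3 with h | h
  · exact absurd h hd0
  · rcases mul_eq_zero.1 h with h | h
    · subst h
      rw [← hc'] at hd'
      simp only [zero_smul, map_zero] at hd'
      rw [hd'] at hne; exact hne rfl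
    · rw [h] at h2; simp at h2

/-- A skew operator of rank two squares to a nonzero multiple of the identity on its range. -/
theorem exists_sq_eq_smul_of_skew [FiniteDimensional ℝ V] (hpos : ∀ v, v ≠ 0 → 0 < B v v)
    (hsymm : ∀ u v, B u v = B v u)
    (hskew : ∀ u v, B (L u) v = -B u (L v))
    (hrank : Module.finrank ℝ (LinearMap.range L) = 2) :
    ∃ a : ℝ, a ≠ 0 ∧ ∀ w ∈ LinearMap.range L, L (L w) = a • w := by
  have hL : L ≠ 0 := by
    rintro rfl
    rw [LinearMap.range_zero, finrank_bot] at hrank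
    exact absurd hrank (by norm_num)
  obtain ⟨u, hu⟩ : ∃ u, L u ≠ 0 := by
    by_contra! h
    exact hL (LinearMap.ext h)
  have hLu : L (L u) ≠ 0 := fun h => hu (apply_eq_zero_of_skew hpos hskew h)
  have hperp := inner_apply_self_of_skew hsymm hskew
  have hind : LinearIndependent ℝ ![L u, L (L u)] := by
    rw [LinearIndependent.pair_iff]
    intro s t hst
    have h1 := congrArg (B (L u)) hst
    have h2 := congrArg (B (L (L u))) hst
    simp only [map_add, map_smul, smul_eq_mul, hperp, map_zero, mul_zero, add_zero] at h1
    rw [map_add, map_smul, map_smul, hsymm _ (L u), hperp] at h2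
    simp only [smul_eq_mul, map_zero, mul_zero, zero_add] at h2
    exact ⟨(mul_eq_zero.1 h1).resolve_right (hpos _ hu).ne',
      (mul_eq_zero.1 h2).resolve_right (hpos _ hLu).ne'⟩
  have hspan : Submodule.span ℝ (Set.range ![L u, L (L u)]) = LinearMap.range L := by
    apply Submodule.eq_of_le_of_finrank_eq
    · rw [Submodule.span_le]
      rintro _ ⟨i, rfl⟩
      fin_cases i
      · exact ⟨u, rfl⟩
      · exact ⟨L u, rfl⟩
    · rw [finrank_span_eq_card hind, hrank]; rfl
  have hmem : ∀ w ∈ LinearMap.range L, ∃ s t : ℝ, s • L u + t • L (L u) = w := by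
    intro w hw
    rw [← hspan] at hw
    obtain ⟨c, hc⟩ := (Submodule.mem_span_range_iff_exists_fun ℝ).1 hw
    exact ⟨c 0, c 1, by simpa [Fin.sum_univ_two] using hc⟩
  obtain ⟨a, b, hab⟩ := hmem (L (L (L u))) ⟨_, rfl⟩
  -- `L³ u` is `B`-orthogonal to `L² u`, which kills its component along `L² u`.
  have hb : b = 0 := by
    have h1 := hperp (L (L u))
    rw [← hab, map_add, map_smul, map_smul, hsymm _ (L u), hperp] at h1
    simp only [smul_eq_mul, mul_zero, zero_add] at h1
    exact (mul_eq_zero.1 h1).resolve_right (hpos _ hLu).ne'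
  subst hb
  rw [zero_smul, add_zero] at hab
  refine ⟨a, ?_, fun w hw => ?_⟩
  · rintro rfl
    rw [zero_smul] at hab
    exact hLu (apply_eq_zero_of_skew hpos hskew hab.symm)
  · obtain ⟨s, t, rfl⟩ := hmem w hw
    simp only [map_add, map_smul, ← hab, smul_add]
    rw [smul_comm s, smul_comm t]

variable {G : V →ₗ[ℝ] V →ₗ[ℝ] ℝ}

/-- `B` supplies the independence arguments through `v ⟂ L v ⟂ L² v`, while `G` need only be
nondegenerate: it enters solely through the equivalence of normality with `L² v = a v`. -/
theorem orthogonal_and_oblique_criteria [FiniteDimensional ℝ V]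
    (hpos : ∀ v, v ≠ 0 → 0 < B v v)
    (hsymm : ∀ u v, B u v = B v u)
    (hskew : ∀ u v, B (L u) v = -B u (L v))
    (hrank : Module.finrank ℝ (LinearMap.range L) = 2)
    (hGnd : ∀ v, (∀ w, G v w = 0) → v = 0)
    (hGskew : ∀ u v, G (L u) v = -G u (L v)) (v : V) :
    ((v ≠ 0 ∧ ∀ w, L w = 0 → G v w = 0) ↔
      (LinearIndependent ℝ ![v, L v] ∧ L (L v) ∈ Submodule.span ℝ {v, L v})) ∧
    ((L v ≠ 0 ∧ ¬ ∀ w, L w = 0 → G v w = 0) ↔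
      (LinearIndependent ℝ ![v, L v, L (L v)] ∧
        L (L (L v)) ∈ Submodule.span ℝ {L v, L (L v)})) := by
  obtain ⟨a, ha, hsq⟩ := exists_sq_eq_smul_of_skew hpos hsymm hskew hrank
  have hperp := inner_apply_self_of_skew hsymm hskew
  have hrange : ∀ w, L (L w) = a • w → w ∈ LinearMap.range L := fun w hw =>
    ⟨a⁻¹ • L w, by rw [map_smul, hw, smul_smul, inv_mul_cancel₀ ha, one_smul]⟩
  -- `a⁻¹ L²` is the projection onto the range along the kernel.
  have hsplit : ∀ w, L (w - a⁻¹ • L (L w)) = 0 := fun w => by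
    rw [map_sub, map_smul, hsq (L w) ⟨w, rfl⟩, smul_smul, inv_mul_cancel₀ ha, one_smul, sub_self]
  have hnormal : (∀ w, L w = 0 → G v w = 0) ↔ L (L v) = a • v := by
    constructor
    · intro h
      -- The kernel component of `v` is `G`-orthogonal to the kernel and to the range, hence to
      -- everything.
      have h0 : v - a⁻¹ • L (L v) = 0 := by
        apply hGnd
        intro w
        have hk : ∀ w, L w = 0 → G (v - a⁻¹ • L (L v)) w = 0 := fun w hw => by
          rw [map_sub, map_smul, LinearMap.sub_apply, LinearMap.smul_apply, h w hw, hGskew, hw]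
          simp
        have hr : ∀ w, G (v - a⁻¹ • L (L v)) (L w) = 0 := fun w => by
          have := hGskew (v - a⁻¹ • L (L v)) w
          rw [hsplit] at this
          simp only [map_zero, LinearMap.zero_apply] at this
          linarith
        have h1 := hk _ (hsplit w)
        rw [map_sub, map_smul, hr] at h1
        simpa using h1
      rw [sub_eq_zero] at h0
      conv_rhs => rw [h0]
      rw [smul_smul, mul_inv_cancel₀ ha, one_smul]
    · intro h w hw
      obtain ⟨u, hu⟩ := hrange v h
      rw [← hu, hGskew, hw, map_zero, neg_zero]
  rw [hnormal]
  have hLLv : L (L (L v)) = a • L v := hsq _ ⟨v, rfl⟩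
  constructor
  · constructor
    · rintro ⟨hv, h⟩
      have hLv : L v ≠ 0 := fun h0 => by
        rw [h0, map_zero] at h
        exact hv ((smul_eq_zero.1 h.symm).resolve_left ha)
      refine ⟨?_, ?_⟩
      · rw [LinearIndependent.pair_iff]
        intro s t hst
        have h1 := congrArg (B v) hst
        have h2 := congrArg (B (L v)) hst
        simp only [map_add, map_smul, smul_eq_mul, hperp, map_zero, mul_zero, add_zero] at h1
        rw [map_add, map_smul, map_smul, hsymm _ v, hperp] at h2
        simp only [smul_eq_mul, map_zero, mul_zero, zero_add] at h2
        exact ⟨(mul_eq_zero.1 h1).resolve_right (hpos _ hv).ne',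
          (mul_eq_zero.1 h2).resolve_right (hpos _ hLv).ne'⟩
      · rw [h]
        exact Submodule.smul_mem _ _ (Submodule.subset_span (by simp))
    · rintro ⟨hind, hmem⟩
      refine ⟨hind.ne_zero 0, ?_⟩
      obtain ⟨s, t, hst⟩ := Submodule.mem_span_pair.1 hmem
      -- Applying `L` to `L² v = s v + t L v` gives a relation between the `B`-orthogonal nonzero
      -- vectors `L v` and `L² v`, so `s = a` and `t = 0`.
      have h1 : (s - a) • L v + t • L (L v) = 0 := by
        have := congrArg L hst
        rw [map_add, map_smul, map_smul, hLLv] at this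
        rw [sub_smul, ← this]; abel
      have hLv : L v ≠ 0 := hind.ne_zero 1
      have hLLv0 : L (L v) ≠ 0 := fun h => hLv (apply_eq_zero_of_skew hpos hskew h)
      have h2 := congrArg (B (L v)) h1
      have h3 := congrArg (B (L (L v))) h1
      simp only [map_add, map_smul, smul_eq_mul, hperp, map_zero, mul_zero, add_zero] at h2
      rw [map_add, map_smul, map_smul, hsymm _ (L v), hperp] at h3
      simp only [smul_eq_mul, map_zero, mul_zero, zero_add] at h3
      have hs := (mul_eq_zero.1 h2).resolve_right (hpos _ hLv).ne'
      have ht := (mul_eq_zero.1 h3).resolve_right (hpos _ hLLv0).ne'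
      rw [← hst, ht, sub_eq_zero.1 hs, zero_smul, add_zero]
  · constructor
    · rintro ⟨hLv, hn⟩
      have hLLv0 : L (L v) ≠ 0 := fun h => hLv (apply_eq_zero_of_skew hpos hskew h)
      refine ⟨?_, ?_⟩
      · rw [Fintype.linearIndependent_iff]
        intro c hc
        simp only [Fin.sum_univ_three, Matrix.cons_val_zero, Matrix.cons_val_one,
          Matrix.cons_val_two, Matrix.head_cons, Matrix.tail_cons] at hc
        -- After applying `L`, only `L v` and `L² v` remain, with coefficients `c 0 + a c 2` and `c
        -- 1`.
        have hLc := congrArg L hc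
        simp only [map_add, map_smul, hLLv, map_zero] at hLc
        have h1 := congrArg (B (L v)) hLc
        have h2 := congrArg (B (L (L v))) hLc
        have hp' : B (L (L v)) (L v) = 0 := by rw [hsymm, hperp]
        simp only [map_add, map_smul, smul_eq_mul, hperp, map_zero, mul_zero, add_zero] at h1
        simp only [map_add, map_smul, smul_eq_mul, hp', map_zero, mul_zero, add_zero,
          zero_add] at h2
        have hc1 := (mul_eq_zero.1 h2).resolve_right (hpos _ hLLv0).ne'
        have hc02 : c 0 + c 2 * a = 0 := by
          have : (c 0 + c 2 * a) * B (L v) (L v) = 0 := by linarith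
          exact (mul_eq_zero.1 this).resolve_right (hpos _ hLv).ne'
        have hc2 : c 2 = 0 := by
          by_contra hne
          apply hn
          have h3 : c 2 • (L (L v) - a • v) = 0 := by
            rw [hc1, zero_smul, add_zero, eq_neg_of_add_eq_zero_left hc02] at hc
            rw [← hc, smul_sub, smul_smul, neg_smul]; abel
          exact sub_eq_zero.1 ((smul_eq_zero.1 h3).resolve_left hne)
        have hc0 : c 0 = 0 := by rw [hc2] at hc02; linarith
        intro i
        fin_cases i
        · exact hc0
        · exact hc1
        · exact hc2
      · rw [hLLv]
        exact Submodule.smul_mem _ _ (Submodule.subset_span (by simp))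
    · rintro ⟨hind, -⟩
      refine ⟨hind.ne_zero 1, fun h => ?_⟩
      have h1 := Fintype.linearIndependent_iff.1 hind ![a, 0, -1] (by
        simp [Fin.sum_univ_three, h]) 2
      simp at h1

end SkewOperator

/-! ### Short periodic orbits, and averaging over a period. -/

section PeriodicOrbit

open MeasureTheory

variable {E : Type*} [NormedAddCommGroup E] [NormedSpace ℝ E] [CompleteSpace E]

/-- A periodic orbit of a vector field whose Lipschitz constant is small compared with the
frequency is constant. -/
theorem eq_of_periodic_orbit {X : E → E} {K : NNReal} {s : Set E} {c : ℝ → E} {p : ℝ} (hp : 0 < p)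
    (hper : Function.Periodic c p) (hX : LipschitzOnWith K X s) (hcs : ∀ t, c t ∈ s)
    (hc : ∀ t, HasDerivAt c (X (c t)) t) (hK : K * p < 1) (t : ℝ) : c t = c 0 := by
  have hcc : Continuous c := continuous_iff_continuousAt.2 fun t => (hc t).continuousAt
  have hXc : Continuous fun t => X (c t) := by
    rw [← continuousOn_univ]
    exact hX.continuousOn.comp hcc.continuousOn fun t _ => hcs t
  obtain ⟨t₀, ht₀, hmax⟩ := isCompact_Icc.exists_isMaxOn (s := Icc 0 p) ⟨0, by simp [hp.le]⟩
    hXc.norm.continuousOn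
  set m := ‖X (c t₀)‖ with hm
  have hdist : ∀ x ∈ Icc 0 p, ∀ y ∈ Icc 0 p, ‖c y - c x‖ ≤ m * p := by
    intro x hx y hy
    refine ((convex_Icc 0 p).norm_image_sub_le_of_norm_hasDerivWithin_le
      (fun z _ => (hc z).hasDerivWithinAt) (fun z hz => hmax hz) hx hy).trans ?_
    gcongr
    rw [Real.norm_eq_abs, abs_le]
    constructor <;> linarith [hx.1, hx.2, hy.1, hy.2]
  -- The velocity has mean zero over a period, so `p • X (c t₀)` is the integral of `X (c t₀) - X (c
  -- t)`. With `m` the maximal speed this gives `p m ≤ K (m p) p`, and `K p < 1` forces `m = 0`.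
  have hint : ∫ t in (0 : ℝ)..p, X (c t) = 0 := by
    rw [intervalIntegral.integral_eq_sub_of_hasDerivAt (fun x _ => hc x)
      (hXc.intervalIntegrable _ _)]
    have := hper 0
    rw [zero_add] at this
    rw [this, sub_self]
  have hint2 : ∫ t in (0 : ℝ)..p, (X (c t₀) - X (c t)) = p • X (c t₀) := by
    rw [intervalIntegral.integral_sub (by simp) (hXc.intervalIntegrable _ _), hint]
    simp
  have hle : ‖p • X (c t₀)‖ ≤ (K * (m * p)) * |p - 0| := by
    rw [← hint2]
    apply intervalIntegral.norm_integral_le_of_norm_le_const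
    intro x hx
    rw [uIoc_of_le hp.le] at hx
    refine (hX.norm_sub_le (hcs _) (hcs _)).trans ?_
    gcongr
    exact hdist x ⟨hx.1.le, hx.2⟩ t₀ ht₀
  rw [norm_smul, Real.norm_of_nonneg hp.le, sub_zero, abs_of_pos hp, ← hm] at hle
  have hm0 : m = 0 := by
    by_contra hne
    have hmp : 0 < m := lt_of_le_of_ne (norm_nonneg _) (Ne.symm hne)
    have : 0 < p * m := mul_pos hp hmp
    nlinarith
  have hz : ∀ t, X (c t) = 0 := by
    intro t
    obtain ⟨u, hu, hcu⟩ := hper.exists_mem_Ico₀ hp t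
    rw [hcu]
    have h1 : ‖X (c u)‖ ≤ m := hmax ⟨hu.1, hu.2.le⟩
    rw [hm0] at h1
    exact norm_le_zero_iff.1 h1
  exact is_const_of_deriv_eq_zero (fun t => (hc t).differentiableAt)
    (fun t => by rw [(hc t).deriv, hz]) t 0

/-- The averaged inner product over a periodic one-parameter group of linear maps is invariant:
its generator is skew for a positive definite form. -/
theorem exists_invariant_form {E : Type*} [NormedAddCommGroup E] [InnerProductSpace ℝ E]
    [FiniteDimensional ℝ E]
    {T : ℝ → E →L[ℝ] E} {L : E →L[ℝ] E} {p : ℝ} (hp : 0 < p) (h0 : T 0 = .id ℝ E)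
    (hper : Function.Periodic T p) (hT : ∀ t u, HasDerivAt (fun t => T t u) (T t (L u)) t) :
    ∃ B : E →ₗ[ℝ] E →ₗ[ℝ] ℝ, (∀ v, v ≠ 0 → 0 < B v v) ∧ (∀ u v, B u v = B v u) ∧
      ∀ u v, B (L u) v = -B u (L v) := by
  have hc : ∀ u, Continuous fun t => T t u := fun u =>
    continuous_iff_continuousAt.2 fun t => (hT t u).continuousAt
  have hci : ∀ u v, Continuous fun t => inner ℝ (T t u) (T t v) := fun u v =>
    (hc u).inner (hc v)
  have hii : ∀ u v, IntervalIntegrable (fun t => inner ℝ (T t u) (T t v)) volume 0 p :=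
    fun u v => (hci u v).intervalIntegrable _ _
  refine ⟨LinearMap.mk₂ ℝ (fun u v => ∫ t in (0 : ℝ)..p, inner ℝ (T t u) (T t v)) ?_ ?_ ?_ ?_,
    ?_, ?_, ?_⟩
  · intro u u' v
    simp only [map_add, inner_add_left]
    exact intervalIntegral.integral_add (hii _ _) (hii _ _)
  · intro c u v
    simp [inner_smul_left]
  · intro u u' v
    simp only [map_add, inner_add_right]
    exact intervalIntegral.integral_add (hii _ _) (hii _ _)
  · intro c u v
    simp [inner_smul_right]
  · intro v hv
    apply intervalIntegral.integral_pos hp (hci v v).continuousOn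
      (fun x _ => real_inner_self_nonneg)
    exact ⟨0, ⟨le_rfl, hp.le⟩, by rw [h0]; exact real_inner_self_pos.2 hv⟩
  · intro u v
    simp only [LinearMap.mk₂_apply, real_inner_comm]
  · intro u v
    simp only [LinearMap.mk₂_apply]
    -- The sum of the integrands is the derivative of `⟪T t u, T t v⟫`, whose integral over a period
    -- vanishes.
    rw [eq_neg_iff_add_eq_zero, ← intervalIntegral.integral_add (hii _ _) (hii _ _)]
    have := intervalIntegral.integral_eq_sub_of_hasDerivAt (a := 0) (b := p)
      (fun t _ => (hT t u).inner ℝ (hT t v)) (((hci _ _).add (hci _ _)).intervalIntegrable _ _)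
    rw [← zero_add p, hper 0, sub_self] at this
    rw [zero_add] at this
    rw [← this]
    congr 1
    ext t
    rw [add_comm]

end PeriodicOrbit

/-! ### The action and the Killing field in a chart. -/

noncomputable section ChartFlow

variable {M : Type*} [TopologicalSpace M] [ChartedSpace (EuclideanSpace ℝ (Fin 4)) M]

variable [IsManifold (𝓡 4) ∞ M] {g : LorentzianMetric M}

namespace AxialSymmetry

variable (A : AxialSymmetry g) (Q : M)

/-- The action of the torus, read in the chart at `Q`. -/
def chartFlow (p : ℝ × EuclideanSpace ℝ (Fin 4)) : EuclideanSpace ℝ (Fin 4) :=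
  extChartAt (𝓡 4) Q (A.τ (Circle.exp p.1) ((extChartAt (𝓡 4) Q).symm p.2))

/-- The axial Killing vector field, read in the chart at `Q`. -/
def chartKilling (y : EuclideanSpace ℝ (Fin 4)) : EuclideanSpace ℝ (Fin 4) :=
  fderiv ℝ (A.chartFlow Q) (0, y) (1, 0)

/-- The linearization at `Q` of the axial Killing vector field. -/
def linearization : EuclideanSpace ℝ (Fin 4) →L[ℝ] EuclideanSpace ℝ (Fin 4) :=
  fderiv ℝ (A.chartKilling Q) (extChartAt (𝓡 4) Q Q)

/-- The differential at `Q` of the action, read in the chart at `Q`. -/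
def isotropy (φ : ℝ) : EuclideanSpace ℝ (Fin 4) →L[ℝ] EuclideanSpace ℝ (Fin 4) :=
  (fderiv ℝ (A.chartFlow Q) (φ, extChartAt (𝓡 4) Q Q)).comp (.inr ℝ _ _)

theorem contMDiff_uncurried_exp :
    ContMDiff (𝓘(ℝ, ℝ).prod (𝓡 4)) (𝓡 4) ∞ (fun p : ℝ × M => A.τ (Circle.exp p.1) p.2) :=
  A.contMDiff.comp ((contMDiff_circleExp.comp contMDiff_fst).prodMk contMDiff_snd)

theorem contMDiff_orbit (x : M) :
    ContMDiff 𝓘(ℝ, ℝ) (𝓡 4) ∞ (fun φ : ℝ => A.τ (Circle.exp φ) x) :=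
  A.contMDiff_uncurried_exp.comp (contMDiff_id.prodMk contMDiff_const)

theorem contMDiff_act (z : Circle) : ContMDiff (𝓡 4) (𝓡 4) ∞ (A.τ z) :=
  A.contMDiff.comp (contMDiff_const.prodMk contMDiff_id)

variable {Q}

theorem contDiffAt_chartFlow {p : ℝ × EuclideanSpace ℝ (Fin 4)}
    (hp : p.2 ∈ (extChartAt (𝓡 4) Q).target)
    (hs : A.τ (Circle.exp p.1) ((extChartAt (𝓡 4) Q).symm p.2) ∈ (extChartAt (𝓡 4) Q).source) :
    ContDiffAt ℝ ∞ (A.chartFlow Q) p := by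
  rw [← contMDiffAt_iff_contDiffAt]
  have h1 : ContMDiffAt 𝓘(ℝ, ℝ × EuclideanSpace ℝ (Fin 4)) (𝓡 4) ∞
      (fun p : ℝ × EuclideanSpace ℝ (Fin 4) => (extChartAt (𝓡 4) Q).symm p.2) p :=
    ((contMDiffOn_extChartAt_symm Q).contMDiffAt
      (extChartAt_target_mem_nhds' hp)).comp p contDiff_snd.contMDiff.contMDiffAt
  have h2 : ContMDiffAt 𝓘(ℝ, ℝ × EuclideanSpace ℝ (Fin 4)) (𝓡 4) ∞
      (fun p : ℝ × EuclideanSpace ℝ (Fin 4) =>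
        A.τ (Circle.exp p.1) ((extChartAt (𝓡 4) Q).symm p.2)) p :=
    (A.contMDiff_uncurried_exp.contMDiffAt).comp p
      ((contDiff_fst.contMDiff.contMDiffAt).prodMk h1)
  rw [extChartAt_source] at hs
  exact (contMDiffAt_extChartAt' hs).comp p h2

/-- The group law survives in the chart as long as the intermediate point lies in the chart domain;
the final point may leave it. -/
theorem chartFlow_add {s t : ℝ} {y : EuclideanSpace ℝ (Fin 4)}
    (hs : A.τ (Circle.exp t) ((extChartAt (𝓡 4) Q).symm y) ∈ (extChartAt (𝓡 4) Q).source) :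
    A.chartFlow Q (s + t, y) = A.chartFlow Q (s, A.chartFlow Q (t, y)) := by
  simp only [chartFlow]
  rw [(extChartAt (𝓡 4) Q).left_inv hs, Circle.exp_add, A.mul_act]

theorem chartFlow_periodic (y : EuclideanSpace ℝ (Fin 4)) :
    Function.Periodic (fun t => A.chartFlow Q (t, y)) (2 * Real.pi) := by
  intro t
  simp only [chartFlow, Circle.exp_add, Circle.exp_two_pi, mul_one]

theorem chartFlow_zero {y : EuclideanSpace ℝ (Fin 4)} (hy : y ∈ (extChartAt (𝓡 4) Q).target) :
    A.chartFlow Q (0, y) = y := by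
  simp only [chartFlow, Circle.exp_zero, A.one_act]
  exact (extChartAt (𝓡 4) Q).right_inv hy

theorem contDiffAt_chartFlow_zero {y : EuclideanSpace ℝ (Fin 4)}
    (hy : y ∈ (extChartAt (𝓡 4) Q).target) : ContDiffAt ℝ ∞ (A.chartFlow Q) (0, y) :=
  A.contDiffAt_chartFlow hy (by
    simp only [Circle.exp_zero, A.one_act]
    exact (extChartAt (𝓡 4) Q).map_target hy)

theorem contDiffAt_chartKilling {y : EuclideanSpace ℝ (Fin 4)}
    (hy : y ∈ (extChartAt (𝓡 4) Q).target) : ContDiffAt ℝ ∞ (A.chartKilling Q) y := by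
  have h1 : ContDiffAt ℝ ∞ (fderiv ℝ (A.chartFlow Q)) (0, y) :=
    (A.contDiffAt_chartFlow_zero hy).fderiv_right (by simp)
  exact (h1.comp (x := y) (f := fun y => ((0 : ℝ), y))
    (contDiffAt_const.prodMk contDiffAt_id)).clm_apply contDiffAt_const

theorem chartKilling_eq {y : EuclideanSpace ℝ (Fin 4)} (hy : y ∈ (extChartAt (𝓡 4) Q).target) :
    A.chartKilling Q y = mfderiv (𝓡 4) 𝓘(ℝ, EuclideanSpace ℝ (Fin 4)) (extChartAt (𝓡 4) Q)
      ((extChartAt (𝓡 4) Q).symm y) (A.killing ((extChartAt (𝓡 4) Q).symm y)) := by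
  set x := (extChartAt (𝓡 4) Q).symm y with hx
  have hxs : x ∈ (chartAt (EuclideanSpace ℝ (Fin 4)) Q).source := by
    rw [← extChartAt_source (𝓡 4)]
    exact (extChartAt (𝓡 4) Q).map_target hy
  have h1 : HasMFDerivAt 𝓘(ℝ, ℝ) (𝓡 4) (fun φ : ℝ => A.τ (Circle.exp φ) x) 0
      (mfderiv 𝓘(ℝ, ℝ) (𝓡 4) (fun φ : ℝ => A.τ (Circle.exp φ) x) 0) :=
    ((A.contMDiff_orbit x).mdifferentiable (by simp) 0).hasMFDerivAt
  have hx0 : A.τ (Circle.exp 0) x = x := by rw [Circle.exp_zero, A.one_act]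
  have h2 : HasMFDerivAt (𝓡 4) 𝓘(ℝ, EuclideanSpace ℝ (Fin 4)) (extChartAt (𝓡 4) Q)
      (A.τ (Circle.exp 0) x)
      (mfderiv (𝓡 4) 𝓘(ℝ, EuclideanSpace ℝ (Fin 4)) (extChartAt (𝓡 4) Q) x) := by
    rw [hx0]
    exact (mdifferentiableAt_extChartAt hxs).hasMFDerivAt
  have h3 := (HasMFDerivAt.comp 0 h2 h1).hasFDerivAt
  have h4 : HasFDerivAt (fun φ : ℝ => A.chartFlow Q (φ, y)) _ 0 :=
    HasFDerivAt.comp (g := A.chartFlow Q) (0 : ℝ)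
      ((A.contDiffAt_chartFlow_zero hy).differentiableAt (by simp)).hasFDerivAt
      (hasFDerivAt_prodMk_left (0 : ℝ) y)
  have h5 := h4.unique h3
  exact congrArg (fun T : ℝ →L[ℝ] EuclideanSpace ℝ (Fin 4) => T 1) h5

/-- The manifold bracket is computed from fields pulled back by the inverse chart; this identifies
the pulled-back Killing field. -/
theorem mpullbackWithin_killing {y : EuclideanSpace ℝ (Fin 4)}
    (hy : y ∈ (extChartAt (𝓡 4) Q).target) :
    VectorField.mpullbackWithin 𝓘(ℝ, EuclideanSpace ℝ (Fin 4)) (𝓡 4) (extChartAt (𝓡 4) Q).symm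
      A.killing (range (𝓡 4)) y = A.chartKilling Q y := by
  rw [A.chartKilling_eq hy]
  refine (isInvertible_mfderivWithin_extChartAt_symm hy).inverse_apply_eq.2 ?_
  exact (DFunLike.congr_fun (mfderivWithin_extChartAt_symm_comp_mfderiv_extChartAt hy)
    (A.killing ((extChartAt (𝓡 4) Q).symm y))).symm

/-! ### The isotropy representation at a point of the axis. -/

variable (hQ : Q ∈ A.axis)
include hQ

theorem chartFlow_center (t : ℝ) :
    A.chartFlow Q (t, extChartAt (𝓡 4) Q Q) = extChartAt (𝓡 4) Q Q := by
  simp only [chartFlow, extChartAt_to_inv, hQ (Circle.exp t)]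

theorem contDiffAt_chartFlow_center (t : ℝ) :
    ContDiffAt ℝ ∞ (A.chartFlow Q) (t, extChartAt (𝓡 4) Q Q) :=
  A.contDiffAt_chartFlow (mem_extChartAt_target Q) (by
    simp only [extChartAt_to_inv, hQ (Circle.exp t), mem_extChartAt_source])

theorem chartKilling_center : A.chartKilling Q (extChartAt (𝓡 4) Q Q) = 0 := by
  have h4 : HasFDerivAt (fun φ : ℝ => A.chartFlow Q (φ, extChartAt (𝓡 4) Q Q)) _ 0 :=
    HasFDerivAt.comp (g := A.chartFlow Q) (0 : ℝ)
      ((A.contDiffAt_chartFlow_center hQ 0).differentiableAt (by simp)).hasFDerivAt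
      (hasFDerivAt_prodMk_left (0 : ℝ) _)
  simp only [A.chartFlow_center hQ] at h4
  have h5 := h4.unique (hasFDerivAt_const _ _)
  exact congrArg (fun T : ℝ →L[ℝ] EuclideanSpace ℝ (Fin 4) => T 1) h5

/-- On the axis the bracket with the Killing field only depends on the value of the field. -/
theorem bracket_eq (X : (x : M) → TangentSpace (𝓡 4) x) :
    A.bracket X Q = A.linearization Q (X Q) := by
  set q := extChartAt (𝓡 4) Q Q with hq
  let W : EuclideanSpace ℝ (Fin 4) → EuclideanSpace ℝ (Fin 4) :=
    VectorField.mpullbackWithin 𝓘(ℝ, EuclideanSpace ℝ (Fin 4)) (𝓡 4)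
      (extChartAt (𝓡 4) Q).symm A.killing (range (𝓡 4))
  let V : EuclideanSpace ℝ (Fin 4) → EuclideanSpace ℝ (Fin 4) :=
    VectorField.mpullbackWithin 𝓘(ℝ, EuclideanSpace ℝ (Fin 4)) (𝓡 4)
      (extChartAt (𝓡 4) Q).symm X (range (𝓡 4))
  have hW' : W =ᶠ[𝓝 q] A.chartKilling Q := by
    filter_upwards [extChartAt_target_mem_nhds (I := 𝓡 4) Q] with y hy
    exact A.mpullbackWithin_killing hy
  have hset : (extChartAt (𝓡 4) Q).symm ⁻¹' univ ∩ range (𝓡 4) = univ := by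
    rw [ModelWithCorners.range_eq_univ, preimage_univ, univ_inter]
  have hVq : V q = X Q := by
    have h : ∀ x : M, x = Q → @Eq (EuclideanSpace ℝ (Fin 4)) (X x) (X Q) := by
      rintro x rfl; rfl
    refine (isInvertible_mfderivWithin_extChartAt_symm
      (mem_extChartAt_target Q)).inverse_apply_eq.2 ?_
    refine (h _ (extChartAt_to_inv Q)).trans ?_
    exact (DFunLike.congr_fun (mfderivWithin_range_extChartAt_symm (I := 𝓡 4) (x := Q)) _).symm
  have h1 : VectorField.lieBracketWithin ℝ V W
      ((extChartAt (𝓡 4) Q).symm ⁻¹' univ ∩ range (𝓡 4)) q = A.linearization Q (X Q) := by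
    rw [hset, VectorField.lieBracketWithin_univ, VectorField.lieBracket_eq]
    -- The derivative of `V` is applied to `W q = 0`, so that term drops out whatever the regularity
    -- of `X`; this is what allows iteration.
    show fderiv ℝ W q (V q) - fderiv ℝ V q (W q) = _
    rw [hW'.fderiv_eq, hW'.self_of_nhds, A.chartKilling_center hQ, map_zero, sub_zero, hVq]
    rfl
  refine (isInvertible_mfderiv_extChartAt (mem_extChartAt_source Q)).inverse_apply_eq.2 ?_
  exact h1.trans (DFunLike.congr_fun (mfderiv_extChartAt_self (I := 𝓡 4) (x := Q)) _).symm

theorem hasFDerivAt_chartFlow_snd (t : ℝ) :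
    HasFDerivAt (fun y => A.chartFlow Q (t, y)) (A.isotropy Q t) (extChartAt (𝓡 4) Q Q) :=
  ((A.contDiffAt_chartFlow_center hQ t).differentiableAt (by simp)).hasFDerivAt.comp
    (extChartAt (𝓡 4) Q Q) (hasFDerivAt_prodMk_right t _)

theorem isotropy_zero : A.isotropy Q 0 = .id ℝ _ := by
  refine (A.hasFDerivAt_chartFlow_snd hQ 0).unique ((hasFDerivAt_id _).congr_of_eventuallyEq ?_)
  filter_upwards [extChartAt_target_mem_nhds (I := 𝓡 4) Q] with y hy
  exact A.chartFlow_zero hy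

theorem isotropy_periodic : Function.Periodic (A.isotropy Q) (2 * Real.pi) := by
  intro t
  refine (A.hasFDerivAt_chartFlow_snd hQ _).unique ?_
  have h := A.hasFDerivAt_chartFlow_snd hQ t
  have : (fun y => A.chartFlow Q (t + 2 * Real.pi, y)) = fun y => A.chartFlow Q (t, y) :=
    funext fun y => A.chartFlow_periodic y t
  rwa [this]

theorem eventually_mem_source (t : ℝ) : ∀ᶠ y in 𝓝 (extChartAt (𝓡 4) Q Q),
    A.τ (Circle.exp t) ((extChartAt (𝓡 4) Q).symm y) ∈ (extChartAt (𝓡 4) Q).source := by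
  have h1 : ContinuousAt (fun y => A.τ (Circle.exp t) ((extChartAt (𝓡 4) Q).symm y))
      (extChartAt (𝓡 4) Q Q) :=
    (A.contMDiff_act _).continuous.continuousAt.comp (continuousAt_extChartAt_symm Q)
  apply h1.preimage_mem_nhds
  rw [extChartAt_to_inv, hQ (Circle.exp t)]
  exact extChartAt_source_mem_nhds Q

theorem isotropy_add (s t : ℝ) :
    A.isotropy Q (s + t) = (A.isotropy Q s).comp (A.isotropy Q t) := by
  refine (A.hasFDerivAt_chartFlow_snd hQ _).unique ?_
  have h1 : HasFDerivAt (fun y => A.chartFlow Q (s, y)) (A.isotropy Q s)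
      (A.chartFlow Q (t, extChartAt (𝓡 4) Q Q)) := by
    rw [A.chartFlow_center hQ]
    exact A.hasFDerivAt_chartFlow_snd hQ s
  refine (HasFDerivAt.comp (g := fun y => A.chartFlow Q (s, y)) (extChartAt (𝓡 4) Q Q) h1
    (A.hasFDerivAt_chartFlow_snd hQ t)).congr_of_eventuallyEq ?_
  filter_upwards [A.eventually_mem_source hQ t] with y hy
  exact A.chartFlow_add hy

/-- Symmetry of the second derivative of the flow: differentiating in space and then in time equals
differentiating in time and then in space. -/
theorem hasDerivAt_isotropy_zero (u : EuclideanSpace ℝ (Fin 4)) :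
    HasDerivAt (fun t => A.isotropy Q t u) (A.linearization Q u) 0 := by
  set q := extChartAt (𝓡 4) Q Q with hq
  have hc := A.contDiffAt_chartFlow_center hQ 0
  have hd : HasFDerivAt (fderiv ℝ (A.chartFlow Q)) _ (0, q) :=
    ((hc.fderiv_right (m := ∞) (by simp)).differentiableAt (by simp)).hasFDerivAt
  have h1 : HasFDerivAt (fun t : ℝ => fderiv ℝ (A.chartFlow Q) (t, q) (0, u)) _ 0 :=
    (hd.comp (0 : ℝ) (hasFDerivAt_prodMk_left (0 : ℝ) q)).clm_apply (hasFDerivAt_const ((0 : ℝ), u) (0 : ℝ))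
  have h2 : HasFDerivAt (fun y => fderiv ℝ (A.chartFlow Q) (0, y) (1, 0)) _ q :=
    (hd.comp q (hasFDerivAt_prodMk_right (0 : ℝ) q)).clm_apply (hasFDerivAt_const ((1 : ℝ), (0 : EuclideanSpace ℝ (Fin 4))) q)
  have hsymm := hc.isSymmSndFDerivAt
    (by rw [minSmoothness_of_isRCLikeNormedField]; exact ENat.LEInfty.out) (0, u) (1, 0)
  have h3 : A.linearization Q u = _ := congrArg (fun T => T u) h2.fderiv
  rw [h3]
  convert! h1.hasDerivAt using 1
  simpa using hsymm

theorem hasDerivAt_isotropy (t : ℝ) (u : EuclideanSpace ℝ (Fin 4)) :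
    HasDerivAt (fun t => A.isotropy Q t u) (A.isotropy Q t (A.linearization Q u)) t := by
  have h1 : HasDerivAt (fun s => A.isotropy Q (s - t) u) (A.linearization Q u) t := by
    apply HasDerivAt.comp_sub_const (f := fun s => A.isotropy Q s u)
    rw [sub_self]
    exact A.hasDerivAt_isotropy_zero hQ u
  have h2 := (A.isotropy Q t).hasFDerivAt.comp_hasDerivAt t h1
  convert! h2 using 1
  ext1 s
  simp only [Function.comp_apply]
  rw [← ContinuousLinearMap.comp_apply, ← A.isotropy_add hQ, add_sub_cancel]

theorem mfderiv_act (t : ℝ) (v : EuclideanSpace ℝ (Fin 4)) :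
    mfderiv (𝓡 4) (𝓡 4) (A.τ (Circle.exp t)) Q v = A.isotropy Q t v := by
  have h1 : HasFDerivWithinAt (writtenInExtChartAt (𝓡 4) (𝓡 4) Q (A.τ (Circle.exp t)))
      (A.isotropy Q t) (range (𝓡 4)) (extChartAt (𝓡 4) Q Q) := by
    have h2 : writtenInExtChartAt (𝓡 4) (𝓡 4) Q (A.τ (Circle.exp t)) =
        fun y => A.chartFlow Q (t, y) := by
      ext1 y
      simp only [writtenInExtChartAt, Function.comp_apply, chartFlow, hQ (Circle.exp t)]
    rw [h2]
    exact (A.hasFDerivAt_chartFlow_snd hQ t).hasFDerivWithinAt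
  have h : HasMFDerivAt (𝓡 4) (𝓡 4) (A.τ (Circle.exp t)) Q (A.isotropy Q t) :=
    ⟨(A.contMDiff_act _).continuous.continuousAt, h1⟩
  exact congrArg (fun T => T v) h.mfderiv

theorem inner_isotropy (t : ℝ) (u v : EuclideanSpace ℝ (Fin 4)) :
    g.inner Q (A.isotropy Q t u) (A.isotropy Q t v) = g.inner Q u v := by
  have h1 := A.isometry (Circle.exp t) Q u v
  -- The image of `Q` equals `Q` only propositionally, so the metric is transported between the two
  -- fibres, both of which are the model space.
  have h2 : ∀ x : M, x = Q → ∀ u v : EuclideanSpace ℝ (Fin 4),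
      g.inner x u v = g.inner Q u v := by
    rintro x rfl u v; rfl
  rw [← h1]
  refine Eq.trans ?_ (h2 _ (hQ (Circle.exp t)) _ _).symm
  rw [← A.mfderiv_act hQ, ← A.mfderiv_act hQ]

/-- Differentiate the invariance of the metric under the isotropy at time zero. -/
theorem linearization_skew (u v : EuclideanSpace ℝ (Fin 4)) :
    g.inner Q (A.linearization Q u) v = -g.inner Q u (A.linearization Q v) := by
  let G : EuclideanSpace ℝ (Fin 4) →L[ℝ] EuclideanSpace ℝ (Fin 4) →L[ℝ] ℝ := g.inner Q
  have h1 : HasDerivAt (fun t => G (A.isotropy Q t u) (A.isotropy Q t v)) _ 0 :=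
    (G.hasFDerivAt.comp_hasDerivAt (0 : ℝ) (A.hasDerivAt_isotropy_zero hQ u)).clm_apply
      (A.hasDerivAt_isotropy_zero hQ v)
  have h2 : (fun t => G (A.isotropy Q t u) (A.isotropy Q t v)) = fun _ => G u v :=
    funext fun t => A.inner_isotropy hQ t u v
  rw [h2] at h1
  have h3 := h1.unique (hasDerivAt_const _ _)
  rw [Function.comp_apply, A.isotropy_zero hQ] at h3
  exact eq_neg_of_add_eq_zero_left h3

end AxialSymmetry

end ChartFlow

/-! ### Tangent vectors of a two-dimensional surface. -/

noncomputable section TangentPlane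

variable {M : Type*} [TopologicalSpace M] [ChartedSpace (EuclideanSpace ℝ (Fin 4)) M]

/-- The velocity of a curve is the derivative of its expression in the chart. -/
theorem hasDerivAt_extChartAt_curve {γ : ℝ → M} {Q : M} (hγ : γ 0 = Q)
    (h : ContMDiffAt 𝓘(ℝ, ℝ) (𝓡 4) ∞ γ 0) :
    HasDerivAt (F := EuclideanSpace ℝ (Fin 4)) (fun t => extChartAt (𝓡 4) Q (γ t))
      (mfderiv 𝓘(ℝ, ℝ) (𝓡 4) γ 0 (1 : ℝ)) 0 := by
  subst hγ
  let D : ℝ →L[ℝ] EuclideanSpace ℝ (Fin 4) := mfderiv 𝓘(ℝ, ℝ) (𝓡 4) γ 0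
  have h1 : HasFDerivWithinAt (fun t => extChartAt (𝓡 4) (γ 0) (γ t)) D (range 𝓘(ℝ, ℝ)) 0 :=
    (h.mdifferentiableAt (by simp)).hasMFDerivAt.2
  rw [ModelWithCorners.range_eq_univ, hasFDerivWithinAt_univ] at h1
  exact h1.hasDerivAt

/-- Moving along the coordinate of index 2 in an adapted chart leaves the surface at once. -/
theorem IsTwoSurface.not_mem_nhds {S : Set M} (hS : IsTwoSurface S) {Q : M}
    (hQ : Q ∈ S) : S ∉ 𝓝 Q := by
  intro hn
  obtain ⟨e, -, hQe, hSe⟩ := hS.2 Q hQ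
  have heQ : e Q ∈ e.target := e.map_source hQe
  have h1 : ∀ᶠ y in 𝓝 (e Q), e.symm y ∈ S := by
    apply (e.continuousAt_symm heQ).preimage_mem_nhds
    rwa [e.left_inv hQe]
  have hl : ContinuousAt (fun t : ℝ => e Q + t • EuclideanSpace.single (2 : Fin 4) (1 : ℝ)) 0 := by
    fun_prop
  have h2 : ∀ᶠ t : ℝ in 𝓝 0, t = 0 := by
    have h3 : ∀ᶠ y in 𝓝 (e Q), y 2 = 0 := by
      filter_upwards [h1, e.open_target.mem_nhds heQ] with y hy hy'
      have := ((hSe _ (e.map_target hy')).1 hy).1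
      rwa [e.right_inv hy'] at this
    have h4 : ∀ᶠ t : ℝ in 𝓝 0,
        (e Q + t • EuclideanSpace.single (2 : Fin 4) (1 : ℝ)) 2 = 0 := by
      apply hl.eventually (p := fun y => y 2 = 0)
      simpa using h3
    filter_upwards [h4] with t ht
    have := ((hSe Q hQe).1 hQ).1
    simpa [this] using ht
  obtain ⟨t, ht, ht'⟩ := ((h2.filter_mono nhdsWithin_le_nhds).and
    (self_mem_nhdsWithin (s := {(0 : ℝ)}ᶜ))).exists
  exact ht' ht

variable [IsManifold (𝓡 4) ∞ M] {g : LorentzianMetric M}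

theorem LorentzianMetric.nondegenerate (g : LorentzianMetric M) {Q : M}
    {v : TangentSpace (𝓡 4) Q} (hv : ∀ w, g.inner Q v w = 0) : v = 0 := by
  obtain ⟨b, hb⟩ := g.signature Q
  apply b.repr.injective
  ext j
  have h1 := hv (b j)
  rw [← b.sum_repr v, map_sum, sum_apply] at h1
  simp only [map_smul, smul_apply, hb, smul_eq_mul, mul_ite, mul_zero,
    Finset.sum_ite_eq', Finset.mem_univ, if_true] at h1
  rw [map_zero, Finsupp.zero_apply]
  split_ifs at h1 <;> linarith

/-- The linear parametrization of the plane where the last two coordinates vanish. -/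
def coordinatePlane : (Fin 2 → ℝ) →ₗ[ℝ] EuclideanSpace ℝ (Fin 4) where
  toFun c := !₂[c 0, c 1, 0, 0]
  map_add' c d := by ext i; fin_cases i <;> simp
  map_smul' a c := by ext i; fin_cases i <;> simp

theorem coordinatePlane_injective : Function.Injective coordinatePlane := by
  intro c d h
  ext i
  fin_cases i
  · exact congrArg (fun w : EuclideanSpace ℝ (Fin 4) => w 0) h
  · exact congrArg (fun w : EuclideanSpace ℝ (Fin 4) => w 1) h

/-- The vectors tangent to a two-dimensional surface fill a two-dimensional space. -/
theorem IsTwoSurface.exists_tangent_plane {S : Set M} (hS : IsTwoSurface S) {Q : M}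
    (hQ : Q ∈ S) : ∃ j : (Fin 2 → ℝ) →ₗ[ℝ] EuclideanSpace ℝ (Fin 4),
      Function.Injective j ∧ ∀ c, IsTangentTo S Q (j c) := by
  obtain ⟨e, he, hQe, hSe⟩ := hS.2 Q hQ
  have heQ : e Q ∈ e.target := e.map_source hQe
  have hsymm : ContMDiffAt (𝓡 4) (𝓡 4) ∞ e.symm (e Q) :=
    (contMDiffOn_symm_of_mem_maximalAtlas he).contMDiffAt (e.open_target.mem_nhds heQ)
  have hmap : ContMDiffAt (𝓡 4) (𝓡 4) ∞ e Q :=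
    (contMDiffOn_of_mem_maximalAtlas he).contMDiffAt (e.open_source.mem_nhds hQe)
  have h1 : ContDiffAt ℝ ∞ (fun y => extChartAt (𝓡 4) Q (e.symm y)) (e Q) := by
    rw [← contMDiffAt_iff_contDiffAt]
    refine ContMDiffAt.comp (e Q) (g := extChartAt (𝓡 4) Q) ?_ hsymm
    rw [e.left_inv hQe]
    exact contMDiffAt_extChartAt
  have h2 : ContDiffAt ℝ ∞ (fun y => e ((extChartAt (𝓡 4) Q).symm y)) (extChartAt (𝓡 4) Q Q) := by
    rw [← contMDiffAt_iff_contDiffAt]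
    refine ContMDiffAt.comp (extChartAt (𝓡 4) Q Q) (g := e) ?_
      ((contMDiffOn_extChartAt_symm Q).contMDiffAt (extChartAt_target_mem_nhds Q))
    rw [extChartAt_to_inv]
    exact hmap
  set D := fderiv ℝ (fun y => extChartAt (𝓡 4) Q (e.symm y)) (e Q) with hD
  have hd1 : HasFDerivAt (fun y => extChartAt (𝓡 4) Q (e.symm y)) D (e Q) :=
    (h1.differentiableAt (by simp)).hasFDerivAt
  -- The opposite change of charts has a derivative that is a left inverse of `D`.
  have hDinj : Function.Injective D := by
    have hd2 : HasFDerivAt (fun y => e ((extChartAt (𝓡 4) Q).symm y))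
        (fderiv ℝ (fun y => e ((extChartAt (𝓡 4) Q).symm y)) (extChartAt (𝓡 4) Q Q))
        (extChartAt (𝓡 4) Q (e.symm (e Q))) := by
      rw [e.left_inv hQe]
      exact (h2.differentiableAt (by simp)).hasFDerivAt
    have hd3 := HasFDerivAt.comp (g := fun y => e ((extChartAt (𝓡 4) Q).symm y)) (e Q) hd2 hd1
    have hev : ((fun y => e ((extChartAt (𝓡 4) Q).symm y)) ∘
        fun y => extChartAt (𝓡 4) Q (e.symm y)) =ᶠ[𝓝 (e Q)] id := by
      have hs : ∀ᶠ y in 𝓝 (e Q), e.symm y ∈ (extChartAt (𝓡 4) Q).source := by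
        apply (e.continuousAt_symm heQ).preimage_mem_nhds
        rw [e.left_inv hQe]
        exact extChartAt_source_mem_nhds Q
      filter_upwards [hs, e.open_target.mem_nhds heQ] with y hy hy'
      simp only [Function.comp_apply, (extChartAt (𝓡 4) Q).left_inv hy, e.right_inv hy', id]
    have hd4 := hd3.unique ((hasFDerivAt_id _).congr_of_eventuallyEq hev)
    intro u v huv
    have hu := DFunLike.congr_fun hd4 u
    have hv := DFunLike.congr_fun hd4 v
    simp only [ContinuousLinearMap.comp_apply, ContinuousLinearMap.id_apply] at hu hv
    rw [← hu, ← hv, huv]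
  refine ⟨D.toLinearMap ∘ₗ coordinatePlane, hDinj.comp coordinatePlane_injective, fun c => ?_⟩
  have hl : HasDerivAt (fun t : ℝ => e Q + t • coordinatePlane c) (coordinatePlane c) 0 := by
    simpa using ((hasDerivAt_id (0 : ℝ)).smul_const (coordinatePlane c)).const_add (e Q)
  have hl0 : e Q + (0 : ℝ) • coordinatePlane c = e Q := by simp
  have hγ0 : e.symm (e Q + (0 : ℝ) • coordinatePlane c) = Q := by rw [hl0, e.left_inv hQe]
  have hγ : ContMDiffAt 𝓘(ℝ, ℝ) (𝓡 4) ∞ (fun t : ℝ => e.symm (e Q + t • coordinatePlane c)) 0 := by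
    refine ContMDiffAt.comp (0 : ℝ) (g := e.symm) (I' := 𝓡 4) ?_ ?_
    · rw [hl0]; exact hsymm
    · exact (contDiff_const.add (contDiff_id.smul contDiff_const)).contMDiff.contMDiffAt
  -- The curve is a straight line of the coordinate plane, seen through the adapted chart.
  refine ⟨fun t => e.symm (e Q + t • coordinatePlane c), hγ0, ?_, hγ, ?_⟩
  · have hev : ∀ᶠ t : ℝ in 𝓝 0, e Q + t • coordinatePlane c ∈ e.target := by
      apply hl.continuousAt.preimage_mem_nhds
      rw [hl0]
      exact e.open_target.mem_nhds heQ
    filter_upwards [hev] with t ht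
    rw [hSe _ (e.map_target ht), e.right_inv ht]
    obtain ⟨h2, h3⟩ := (hSe Q hQe).1 hQ
    constructor
    · simp [h2, coordinatePlane]
    · simp [h3, coordinatePlane]
  · have hd5 := hasDerivAt_extChartAt_curve hγ0 hγ
    have hd6 : HasFDerivAt (fun y => extChartAt (𝓡 4) Q (e.symm y)) D
        (e Q + (0 : ℝ) • coordinatePlane c) := by rw [hl0]; exact hd1
    exact hd5.unique (HasFDerivAt.comp_hasDerivAt
      (l := fun y => extChartAt (𝓡 4) Q (e.symm y)) (0 : ℝ) hd6 hl)

/-! ### Rank and kernel of the linearization. -/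

namespace AxialSymmetry

variable (A : AxialSymmetry g) {Q : M}

theorem hasDerivAt_chartFlow_zero {y : EuclideanSpace ℝ (Fin 4)}
    (hy : y ∈ (extChartAt (𝓡 4) Q).target) :
    HasDerivAt (fun t => A.chartFlow Q (t, y)) (A.chartKilling Q y) 0 := by
  have h : HasFDerivAt (fun t : ℝ => A.chartFlow Q (t, y)) _ 0 :=
    HasFDerivAt.comp (g := A.chartFlow Q) (0 : ℝ)
      ((A.contDiffAt_chartFlow_zero hy).differentiableAt (by simp)).hasFDerivAt
      (hasFDerivAt_prodMk_left (0 : ℝ) y)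
  exact h.hasDerivAt

theorem hasDerivAt_chartFlow {y : EuclideanSpace ℝ (Fin 4)} {t : ℝ}
    (hs : A.τ (Circle.exp t) ((extChartAt (𝓡 4) Q).symm y) ∈ (extChartAt (𝓡 4) Q).source) :
    HasDerivAt (fun t => A.chartFlow Q (t, y)) (A.chartKilling Q (A.chartFlow Q (t, y))) t := by
  have h1 : HasDerivAt (fun s => A.chartFlow Q (s - t, A.chartFlow Q (t, y)))
      (A.chartKilling Q (A.chartFlow Q (t, y))) t := by
    apply HasDerivAt.comp_sub_const (f := fun s => A.chartFlow Q (s, A.chartFlow Q (t, y)))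
    rw [sub_self]
    exact A.hasDerivAt_chartFlow_zero ((extChartAt (𝓡 4) Q).map_source hs)
  convert! h1 using 1
  ext1 s
  rw [← A.chartFlow_add hs, sub_add_cancel]

variable (hQ : Q ∈ A.axis)
include hQ

/-- Near a point of the axis the orbits stay near that point. -/
theorem eventually_orbit_mem {s : Set (EuclideanSpace ℝ (Fin 4))}
    (hs : s ∈ 𝓝 (extChartAt (𝓡 4) Q Q)) :
    ∀ᶠ y in 𝓝 (extChartAt (𝓡 4) Q Q), ∀ t : ℝ,
      A.τ (Circle.exp t) ((extChartAt (𝓡 4) Q).symm y) ∈ (extChartAt (𝓡 4) Q).source ∧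
        A.chartFlow Q (t, y) ∈ s := by
  have h1 : ∀ᶠ y in 𝓝 (extChartAt (𝓡 4) Q Q), ∀ t ∈ Icc 0 (2 * Real.pi),
      A.τ (Circle.exp t) ((extChartAt (𝓡 4) Q).symm y) ∈ (extChartAt (𝓡 4) Q).source ∧
        A.chartFlow Q (t, y) ∈ s := by
    -- Compactness of one period makes the neighbourhood uniform in time; periodicity then covers
    -- all times.
    apply isCompact_Icc.eventually_forall_of_forall_eventually
    intro t _
    have hc : ContinuousAt (fun z : EuclideanSpace ℝ (Fin 4) × ℝ =>
        A.τ (Circle.exp z.2) ((extChartAt (𝓡 4) Q).symm z.1)) (extChartAt (𝓡 4) Q Q, t) := by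
      refine ContinuousAt.comp (g := fun p : ℝ × M => A.τ (Circle.exp p.1) p.2)
        (f := fun z : EuclideanSpace ℝ (Fin 4) × ℝ => (z.2, (extChartAt (𝓡 4) Q).symm z.1))
        A.contMDiff_uncurried_exp.continuous.continuousAt (continuousAt_snd.prodMk ?_)
      exact ContinuousAt.comp (g := (extChartAt (𝓡 4) Q).symm) (continuousAt_extChartAt_symm Q)
        continuousAt_fst
    have hQt : A.τ (Circle.exp t) ((extChartAt (𝓡 4) Q).symm (extChartAt (𝓡 4) Q Q)) = Q := by
      rw [extChartAt_to_inv, hQ (Circle.exp t)]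
    refine Filter.Eventually.and ?_ ?_
    · apply hc.preimage_mem_nhds
      rw [hQt]
      exact extChartAt_source_mem_nhds Q
    · have h2 : ContinuousAt (A.chartFlow Q) (t, extChartAt (𝓡 4) Q Q) :=
        (A.contDiffAt_chartFlow_center hQ t).continuousAt
      have h3 : ContinuousAt (fun z : EuclideanSpace ℝ (Fin 4) × ℝ => A.chartFlow Q (z.2, z.1))
          (extChartAt (𝓡 4) Q Q, t) :=
        ContinuousAt.comp (g := A.chartFlow Q)
          (f := fun z : EuclideanSpace ℝ (Fin 4) × ℝ => (z.2, z.1)) h2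
          (continuousAt_snd.prodMk continuousAt_fst)
      apply h3.preimage_mem_nhds
      rwa [A.chartFlow_center hQ]
  filter_upwards [h1] with y hy t
  obtain ⟨u, hu, htu⟩ := Circle.periodic_exp.exists_mem_Ico₀ Real.two_pi_pos t
  have := hy u ⟨hu.1, hu.2.le⟩
  simp only [chartFlow] at this ⊢
  rwa [htu]

/-- With zero linearization the field has a small Lipschitz constant near `Q`, so the nearby orbits,
all of period `2π`, are constant. The axis would then be a neighbourhood of `Q`. -/
theorem linearization_ne_zero : A.linearization Q ≠ 0 := by
  intro h0
  have hstrict := (A.contDiffAt_chartKilling (mem_extChartAt_target (I := 𝓡 4) Q)).hasStrictFDerivAt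
    (by simp)
  -- Any constant below `1 / (2π)` would do.
  obtain ⟨s, hs, hlip⟩ := hstrict.exists_lipschitzOnWith_of_nnnorm_lt (1 / 10) (by
    have : fderiv ℝ (A.chartKilling Q) (extChartAt (𝓡 4) Q Q) = 0 := h0
    rw [this]
    simp)
  have hconst : ∀ᶠ y in 𝓝 (extChartAt (𝓡 4) Q Q), (extChartAt (𝓡 4) Q).symm y ∈ A.axis := by
    filter_upwards [A.eventually_orbit_mem hQ hs, extChartAt_target_mem_nhds (I := 𝓡 4) Q]
      with y hy hyt z
    have h1 := eq_of_periodic_orbit Real.two_pi_pos (A.chartFlow_periodic (Q := Q) y) hlip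
      (fun t => (hy t).2) (fun t => A.hasDerivAt_chartFlow (hy t).1)
      (by push_cast; linarith [Real.pi_lt_four]) (Complex.arg z)
    simp only [A.chartFlow_zero hyt] at h1
    simp only [chartFlow, Circle.exp_arg] at h1
    have h2 := (hy (Complex.arg z)).1
    rw [Circle.exp_arg] at h2
    exact ((extChartAt (𝓡 4) Q).left_inv h2).symm.trans (congrArg (extChartAt (𝓡 4) Q).symm h1)
  apply A.isTwoSurface_fixedPoints.not_mem_nhds hQ
  have h3 := (continuousAt_extChartAt (I := 𝓡 4) Q).eventually hconst
  filter_upwards [h3, extChartAt_source_mem_nhds (I := 𝓡 4) Q] with x hx hxs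
  rw [(extChartAt (𝓡 4) Q).left_inv hxs] at hx
  exact hx

/-- A curve in the axis is fixed pointwise by the action, so its velocity is fixed by every
isotropy; differentiating in the group parameter gives the claim. -/
theorem linearization_eq_zero_of_isTangentTo {v : EuclideanSpace ℝ (Fin 4)}
    (hv : IsTangentTo A.axis Q v) : A.linearization Q v = 0 := by
  obtain ⟨γ, hγ0, hγS, hγ, hγv⟩ := hv
  have h1 : HasDerivAt (fun t => extChartAt (𝓡 4) Q (γ t)) v 0 := by
    rw [← hγv]
    exact hasDerivAt_extChartAt_curve hγ0 hγ
  have h2 : ∀ s, A.isotropy Q s v = v := by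
    intro s
    have h3 : HasFDerivAt (fun y => A.chartFlow Q (s, y)) (A.isotropy Q s)
        (extChartAt (𝓡 4) Q (γ 0)) := by
      rw [hγ0]; exact A.hasFDerivAt_chartFlow_snd hQ s
    refine (h3.comp_hasDerivAt (0 : ℝ) h1).unique (h1.congr_of_eventuallyEq ?_)
    have hs : ∀ᶠ t in 𝓝 (0 : ℝ), γ t ∈ (extChartAt (𝓡 4) Q).source := by
      apply hγ.continuousAt.preimage_mem_nhds
      rw [hγ0]
      exact extChartAt_source_mem_nhds Q
    filter_upwards [hγS, hs] with t ht hts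
    simp only [Function.comp_apply, chartFlow, (extChartAt (𝓡 4) Q).left_inv hts,
      ht (Circle.exp s)]
  have h4 := A.hasDerivAt_isotropy_zero hQ v
  simp only [h2] at h4
  exact h4.unique (hasDerivAt_const _ _)

theorem exists_invariant_form_linearization :
    ∃ B : EuclideanSpace ℝ (Fin 4) →ₗ[ℝ] EuclideanSpace ℝ (Fin 4) →ₗ[ℝ] ℝ,
      (∀ v, v ≠ 0 → 0 < B v v) ∧ (∀ u v, B u v = B v u) ∧
      ∀ u v, B (A.linearization Q u) v = -B u (A.linearization Q v) :=
  exists_invariant_form Real.two_pi_pos (A.isotropy_zero hQ) (A.isotropy_periodic hQ)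
    (A.hasDerivAt_isotropy hQ)

/-- Rank and nullity are each at least two and add up to four, so both equal two, and the plane of
tangent vectors fills the kernel. -/
theorem finrank_range_linearization_and_isTangentTo_iff :
    Module.finrank ℝ (LinearMap.range (A.linearization Q).toLinearMap) = 2 ∧
    ∀ v : EuclideanSpace ℝ (Fin 4), IsTangentTo A.axis Q v ↔ A.linearization Q v = 0 := by
  obtain ⟨B, hpos, hsymm, hskew⟩ := A.exists_invariant_form_linearization hQ
  obtain ⟨j, hj, hjt⟩ := A.isTwoSurface_fixedPoints.exists_tangent_plane hQ
  have h1 : 2 ≤ Module.finrank ℝ (LinearMap.range (A.linearization Q).toLinearMap) :=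
    two_le_finrank_range_of_skew (L := (A.linearization Q).toLinearMap) hpos hsymm hskew
      fun h => A.linearization_ne_zero hQ (ContinuousLinearMap.coe_injective h)
  have h2 := LinearMap.finrank_range_add_finrank_ker (A.linearization Q).toLinearMap
  rw [finrank_euclideanSpace_fin] at h2
  have h3 : LinearMap.range j ≤ LinearMap.ker (A.linearization Q).toLinearMap := by
    rintro _ ⟨c, rfl⟩
    exact A.linearization_eq_zero_of_isTangentTo hQ (hjt c)
  have h4 : Module.finrank ℝ (LinearMap.range j) = 2 := by
    rw [LinearMap.finrank_range_of_inj hj, Module.finrank_fin_fun]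
  have h5 := Submodule.finrank_mono h3
  refine ⟨by omega, fun v => ⟨A.linearization_eq_zero_of_isTangentTo hQ, fun hv => ?_⟩⟩
  have h6 := Submodule.eq_of_le_of_finrank_le h3 (by omega)
  have h7 : v ∈ LinearMap.ker (A.linearization Q).toLinearMap := hv
  rw [← h6] at h7
  obtain ⟨c, rfl⟩ := h7
  exact hjt c

end AxialSymmetry

end TangentPlane

/-! ### The three criteria. -/

theorem theorem2 {M : Type*} [TopologicalSpace M] [ChartedSpace (EuclideanSpace ℝ (Fin 4)) M]
    [IsManifold (𝓡 4) ∞ M] (g : LorentzianMetric M) (A : AxialSymmetry g)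
    (α : (x : M) → TangentSpace (𝓡 4) x)
    (hα : ContMDiff (𝓡 4) (𝓡 4).tangent ∞
      (fun x => (⟨x, α x⟩ : TangentBundle (𝓡 4) M)))
    (Q : M) (hQ : Q ∈ A.axis) :
    (IsTangentTo A.axis Q (α Q) ↔ A.bracket α Q = 0) ∧
    ((α Q ≠ 0 ∧ IsNormalTo g A.axis Q (α Q)) ↔
      (LinearIndependent ℝ ![α Q, A.bracket α Q] ∧
        A.bracket (A.bracket α) Q ∈ Submodule.span ℝ {α Q, A.bracket α Q})) ∧
    ((¬ IsTangentTo A.axis Q (α Q) ∧ ¬ IsNormalTo g A.axis Q (α Q)) ↔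
      (LinearIndependent ℝ ![α Q, A.bracket α Q, A.bracket (A.bracket α) Q] ∧
        A.bracket (A.bracket (A.bracket α)) Q ∈
          Submodule.span ℝ {A.bracket α Q, A.bracket (A.bracket α) Q})) := by
  obtain ⟨hrank, htan⟩ := A.finrank_range_linearization_and_isTangentTo_iff hQ
  obtain ⟨B, hpos, hsymm, hskew⟩ := A.exists_invariant_form_linearization hQ
  let G : EuclideanSpace ℝ (Fin 4) →L[ℝ] EuclideanSpace ℝ (Fin 4) →L[ℝ] ℝ := g.inner Q
  have key := orthogonal_and_oblique_criteria (L := (A.linearization Q).toLinearMap) (B := B)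
    (G := ContinuousLinearMap.coeLM ℝ ∘ₗ G.toLinearMap) hpos hsymm hskew hrank
    (fun v hv => g.nondegenerate (Q := Q) (v := v) hv) (A.linearization_skew hQ) (α Q)
  have hnormal : IsNormalTo g A.axis Q (α Q) ↔
      ∀ w, (A.linearization Q).toLinearMap w = 0 →
        (ContinuousLinearMap.coeLM ℝ ∘ₗ G.toLinearMap) (α Q) w = 0 :=
    forall_congr' fun w => imp_congr (htan w) Iff.rfl
  -- The outermost bracket is rewritten first, exposing the values of the inner ones at `Q`.
  rw [A.bracket_eq hQ (A.bracket (A.bracket α)), A.bracket_eq hQ (A.bracket α),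
    A.bracket_eq hQ α]
  rw [hnormal]
  exact ⟨htan _, key.1, (and_congr (not_congr (htan _)) Iff.rfl).trans key.2⟩
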